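/- For integers $k\ge 2$, $t\ge 2$ and a real number $c>0$, let $T(k,t,c)$ be the $t\times t$ tridiagonal matrix with lower diagonal $(1,\dots,1,c)$, upper diagonal $(k,k-1,\dots,k-1)$ and all row sums equal to $k$ (for $t=2$ the lower diagonal is $(c)$ and the upper diagonal is $(k)$). For real $\lambda$, let $v(k,\lambda)$ be the maximum number of vertices of a connected $k$-regular finite simple graph whose adjacency matrix has second largest eigenvalue (counted with multiplicity) at most $\lambda$, with $v(k,\lambda)=\infty$ if there are arbitrarily large such graphs and $v(k,\lambda)=0$ if there are none. Let $\lambda_2$ be the second largest eigenvalue of $T(k,t,c)$. Then $v(k,\lambda_2)$ is finite and $$v(k,\lambda_2)\le M(k,t,c)=1+\sum_{i=0}^{t-3}k(k-1)^i+\frac{k(k-1)^{t-2}}{c}$$ (the sum is empty if $t=2$). Moreover, let $G$ be a connected $k$-regular graph with second largest eigenvalue at most $\lambda_2$ and with exactly $v(k,\lambda_2)$ vertices. Then $v(k,\lambda_2)=M(k,t,c)$ if and only if $G$ is distance-regular and $T(k,t,c)$ is its quotient matrix with respect to the distance partition (that is, for every vertex $x$ there are exactly $t$ nonempty distance cells $\{y: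 d(x,y)=i\}$, $0\le i\le t-1$, and every vertex of the $i$-th cell has exactly $T(k,t,c)_{ij}$ neighbours in the $j$-th cell). Equivalently, $v(k,\lambda_2)=M(k,t,c)$ if and only if $G$ is distance-regular of diameter $t-1$ with intersection array $\{k,k-1,\dots,k-1;1,\dots,1,c\}$. -/

import Mathlib

noncomputable section

namespace SpectralOrder

/-- The second largest eigenvalue of a real square matrix: the second entry of the list of its
real eigenvalues (the roots of the characteristic polynomial, with multiplicity) in decreasing
order. The default value `0` is used only when there are fewer than two real eigenvalues. -/
def secondLargestEigenvalue {n : Type*} [Fintype n] [DecidableEq n] (A : Matrix n n ℝ) : ℝ :=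
  (A.charpoly.roots.sort (· ≥ ·)).getD 1 0

open Classical in
/-- `G` is a connected `k`-regular graph whose adjacency matrix has second largest eigenvalue
at most `lam`. -/
def IsAdmissible {V : Type*} [Fintype V] (k : ℕ) (lam : ℝ) (G : SimpleGraph V) : Prop :=
  G.Connected ∧ G.IsRegularOfDegree k ∧ secondLargestEigenvalue (G.adjMatrix ℝ) ≤ lam

/-- `v(k, lam)`: the maximum number of vertices of a connected `k`-regular graph whose second
largest eigenvalue is at most `lam`. It is `⊤` if there are arbitrarily large such graphs,
and `0` if there are none. -/
def maxOrder (k : ℕ) (lam : ℝ) : ℕ∞ :=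
  sSup {m : ℕ∞ | ∃ n : ℕ, m = n ∧ ∃ G : SimpleGraph (Fin n), IsAdmissible k lam G}

/-- The sequence `k, k - 1, k - 1, …` (indices `0, 1, 2, …`). -/
def upperEntry (k : ℕ) (i : ℕ) : ℝ := if i = 0 then k else k - 1

/-- The sequence `1, …, 1, c` (indices `1, …, t - 1`, the entry `c` at index `t - 1`). -/
def lowerEntry (t : ℕ) (c : ℝ) (i : ℕ) : ℝ := if i + 1 = t then c else 1

/-- `T(k, t, c)`: the `t × t` tridiagonal matrix with upper diagonal `(k, k - 1, …, k - 1)`,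
lower diagonal `(1, …, 1, c)` and all row sums equal to `k`. -/
def T (k t : ℕ) (c : ℝ) : Matrix (Fin t) (Fin t) ℝ :=
  Matrix.of fun i j =>
    if (i : ℕ) + 1 = j then upperEntry k i
    else if (j : ℕ) + 1 = i then lowerEntry t c i
    else if i = j then
      k - (if (i : ℕ) + 1 < t then upperEntry k i else 0)
        - (if 0 < (i : ℕ) then lowerEntry t c i else 0)
    else 0

/-- `M(k, t, c)`, for `t ≥ 2`. -/
def M (k t : ℕ) (c : ℝ) : ℝ :=
  1 + ∑ i ∈ Finset.range (t - 2), (k : ℝ) * ((k : ℝ) - 1) ^ i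
    + (k : ℝ) * ((k : ℝ) - 1) ^ (t - 2) / c

/-- The number of neighbours of `y` at distance `j` from `x`. -/
def neighborsAtDist {V : Type*} (G : SimpleGraph V) (x y : V) (j : ℕ) : ℕ :=
  Set.ncard {z : V | G.Adj y z ∧ G.dist x z = j}

/-- Distance-regularity: `G` is connected and, for all vertices `x`, `y` at distance `i`, the
number of neighbours of `y` at distance `j` from `x` depends only on `i` and `j`
(it automatically vanishes unless `j` is `i - 1`, `i` or `i + 1`). -/
def IsDistanceRegular {V : Type*} (G : SimpleGraph V) : Prop :=
  G.Connected ∧ ∀ i j : ℕ, ∃ a : ℕ, ∀ x y : V, G.dist x y = i → neighborsAtDist G x y j = a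

/-- For every vertex `x`, the cells of the distance partition with respect to `x` are
`{y | dist x y = i}` for `i = 0, …, t - 1` (all nonempty), and every vertex of the
`i`-th cell has exactly `Q i j` neighbours in the `j`-th cell. -/
def HasDistanceQuotient {V : Type*} (G : SimpleGraph V) {t : ℕ}
    (Q : Matrix (Fin t) (Fin t) ℝ) : Prop :=
  ∀ x : V, (∀ y : V, G.dist x y < t) ∧ (∀ i : Fin t, ∃ y : V, G.dist x y = i) ∧
    ∀ (i j : Fin t) (y : V), G.dist x y = i → (neighborsAtDist G x y j : ℝ) = Q i j

/-- `G` is distance-regular with intersection array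
`{b 0, …, b (d - 1); c 1, …, c d}`, where `d` is its diameter. -/
def HasIntersectionArray {V : Type*} (G : SimpleGraph V) (d : ℕ) (b c : ℕ → ℝ) : Prop :=
  IsDistanceRegular G ∧ G.diam = d ∧
    (∀ x y : V, G.dist x y < d → (neighborsAtDist G x y (G.dist x y + 1) : ℝ) = b (G.dist x y)) ∧
    (∀ x y : V, 0 < G.dist x y → (neighborsAtDist G x y (G.dist x y - 1) : ℝ) = c (G.dist x y))

end SpectralOrder

end

namespace SpectralOrder

/-! The proof is a linear programming bound with non-backtracking walks. Put `t = m + 2`, let `A` be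
the adjacency matrix, `N_i` the matrix counting non-backtracking walks of length `i`, and `J` the
all-one matrix.

Since `T` has constant row sums `k`, it acts on differences of consecutive coordinates through a
smaller matrix `S`, and its characteristic polynomial is `(X - k)` times that of `S`. A parameter `x
< k` is found for which `diffSeq` is a positive eigenvector of `S`; by a Perron argument `x` is the
largest eigenvalue of `S`, hence the second largest of `T` (`secondLargestEigenvalue_T`).

The partial sums of `diffSeq` are the positive coefficients of a combination `H` of `N_0, …, N_m`
with `(A - x) H = c (N_0 + … + N_m) + N_{m+1}` (`apply_partialComb`). Call the right side `B`. On
the all-one vector this reads `(k - x) h = c M`, where `h` is the row sum of `H`.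

If the graph has `n` vertices and second eigenvalue at most `x`, then `P = x - A + ((k - x) / n) J`
is positive semidefinite, so `H P H` has nonnegative trace. As `P H = (c M / n) J - B`, this says `∑
H_ab B_ab ≤ c M h`. Wherever `H_ab ≠ 0`, some integer `N_i(a,b)` with `i ≤ m` is at least `1`, so
`B_ab ≥ c`; the sum is therefore at least `c n h`, and `n ≤ M`.

Equality forces `P H = 0`, that is `B = c J`. Then each `N_i` with `i ≤ m + 1` is a multiple of the
distance-`i` matrix, and the recurrence for `A N_i` gives the entries of `T`. Conversely, counting
edges between consecutive distance layers gives order `M`. -/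

/-! ### The recurrence for eigenvector differences and the choice of `x`. -/

/-- Up to order and scaling, the differences of consecutive entries of an eigenvector of
`T(k, t, c)` for the eigenvalue `x`, starting from the last one. -/
def diffSeq (k c x : ℝ) : ℕ → ℝ
  | 0 => 1
  | 1 => x + c - 1
  | n + 2 => x * diffSeq k c x (n + 1) - (k - 1) * diffSeq k c x n

/-- The partial sums of `diffSeq`. -/
def partialSeq (k c x : ℝ) (n : ℕ) : ℝ := ∑ i ∈ Finset.range (n + 1), diffSeq k c x i

theorem partialSeq_zero (k c x : ℝ) : partialSeq k c x 0 = 1 := by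
  simp [partialSeq, diffSeq]

theorem partialSeq_one (k c x : ℝ) : partialSeq k c x 1 = x + c := by
  simp [partialSeq, Finset.sum_range_succ, diffSeq]

theorem partialSeq_succ (k c x : ℝ) (n : ℕ) :
    partialSeq k c x (n + 1) = partialSeq k c x n + diffSeq k c x (n + 1) :=
  Finset.sum_range_succ _ _

/-- Summing the recurrence of `diffSeq` leaves a constant from the initial values. This constant `c`
becomes the weight of `N_0, …, N_m` in `nbSum`. -/
theorem partialSeq_add_two (k c x : ℝ) (n : ℕ) :
    partialSeq k c x (n + 2) =
      x * partialSeq k c x (n + 1) - (k - 1) * partialSeq k c x n + c := by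
  induction n with
  | zero =>
    rw [partialSeq_succ, partialSeq_one, partialSeq_zero]
    simp only [diffSeq]
    ring
  | succ n ih =>
    have h1 := partialSeq_succ k c x n
    have h2 := partialSeq_succ k c x (n + 1)
    have h3 := partialSeq_succ k c x (n + 2)
    have hd : diffSeq k c x (n + 3) = x * diffSeq k c x (n + 2) - (k - 1) * diffSeq k c x (n + 1) :=
      rfl
    linear_combination h3 + hd + ih - x * h2 + (k - 1) * h1

theorem continuous_diffSeq (k c : ℝ) (n : ℕ) : Continuous fun x => diffSeq k c x n := by
  induction n using Nat.twoStepInduction with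
  | zero => simp only [diffSeq]; fun_prop
  | one => simp only [diffSeq]; fun_prop
  | more n h1 h2 => simp only [diffSeq]; fun_prop

theorem diffSeq_pos_of_le {k c x : ℝ} (hk : 2 ≤ k) (hc : 0 < c) (hx : k ≤ x) (n : ℕ) :
    0 < diffSeq k c x n ∧ diffSeq k c x n ≤ diffSeq k c x (n + 1) := by
  induction n with
  | zero => simp only [diffSeq]; constructor <;> linarith
  | succ n ih =>
    refine ⟨ih.1.trans_le ih.2, ?_⟩
    rw [diffSeq]
    nlinarith [ih.1, ih.2]

/-- The witness is the largest parameter at which one of the required positivity conditions fails.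
The recurrence prevents an intermediate term from vanishing there, so the failure occurs in the
final sum. -/
theorem exists_diffSeq_pos {k c : ℝ} (hk : 2 ≤ k) (hc : 0 < c) (m : ℕ) :
    ∃ x, (∀ i ≤ m, 0 < diffSeq k c x i) ∧ diffSeq k c x (m + 1) + diffSeq k c x m = 0 := by
  set Z : Set ℝ := {x | diffSeq k c x (m + 1) + diffSeq k c x m ≤ 0} ∪
    ⋃ i ∈ Finset.range (m + 1), {x | diffSeq k c x i ≤ 0} with hZ
  have hcont := continuous_diffSeq k c
  have hclosed : IsClosed Z := by
    refine IsClosed.union (isClosed_le ((hcont _).add (hcont _)) continuous_const) ?_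
    exact isClosed_biUnion_finset fun i _ => isClosed_le (hcont i) continuous_const
  have hmem (x : ℝ) : x ∉ Z ↔ 0 < diffSeq k c x (m + 1) + diffSeq k c x m ∧
      ∀ i ≤ m, 0 < diffSeq k c x i := by
    simp [hZ]
  have hbdd : BddAbove Z := by
    refine ⟨k, fun x hx => ?_⟩
    by_contra! h
    have hp := fun n => (diffSeq_pos_of_le hk hc h.le n).1
    exact (hmem x).2 ⟨add_pos (hp _) (hp _), fun i _ => hp i⟩ hx
  have hne : Z.Nonempty := by
    -- At `x = -c` the term of index `1` is `-1`; for `m = 0` the final sum is `0`.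
    refine ⟨-c, ?_⟩
    by_contra h
    rw [hmem] at h
    rcases Nat.eq_zero_or_pos m with rfl | hm
    · have := h.1
      norm_num [diffSeq] at this
    · have := h.2 1 hm
      norm_num [diffSeq] at this
  have hmu := hclosed.csSup_mem hne hbdd
  set x := sSup Z with hx
  have hgt (y : ℝ) (hy : x < y) : y ∉ Z := fun h => (le_csSup hbdd h).not_gt hy
  have hlim (f : ℝ → ℝ) (hf : Continuous f) (h : ∀ y, x < y → 0 < f y) : 0 ≤ f x := by
    have h1 : Filter.Tendsto f (nhdsWithin x (Set.Ioi x)) (nhds (f x)) :=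
      hf.continuousWithinAt
    refine ge_of_tendsto h1 ?_
    filter_upwards [self_mem_nhdsWithin] with y hy using (h y hy).le
  have hlast : 0 ≤ diffSeq k c x (m + 1) + diffSeq k c x m :=
    hlim _ ((hcont _).add (hcont _)) fun y hy => ((hmem y).1 (hgt y hy)).1
  have hnonneg (i : ℕ) (hi : i ≤ m) : 0 ≤ diffSeq k c x i :=
    hlim _ (hcont i) fun y hy => ((hmem y).1 (hgt y hy)).2 i hi
  have hpos (i : ℕ) (hi : i ≤ m) : 0 < diffSeq k c x i := by
    induction i with
    | zero => simp [diffSeq]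
    | succ n ih =>
      have ihn := ih (by omega)
      refine (hnonneg _ hi).lt_of_ne' fun h0 => ?_
      -- After a zero preceded by a positive term the recurrence turns negative, contradicting the
      -- limiting inequalities.
      have h2 : diffSeq k c x (n + 2) < 0 := by
        rw [diffSeq, h0]
        nlinarith
      rcases hi.lt_or_eq with h | h
      · exact (hnonneg (n + 2) h).not_gt h2
      · subst h
        rw [h0] at hlast
        linarith
  refine ⟨x, hpos, hlast.antisymm' ?_⟩
  by_contra! h
  exact (hmem x).2 ⟨h, hpos⟩ hmu

/-! ### Perron-type comparison for a positive eigenvector. -/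

section Perron

variable {n : Type*} [Fintype n] [DecidableEq n]

theorem isRoot_charpoly_iff_exists_mulVec (A : Matrix n n ℝ) (r : ℝ) :
    A.charpoly.IsRoot r ↔ ∃ w ≠ 0, A.mulVec w = r • w := by
  rw [Polynomial.IsRoot, Matrix.eval_charpoly, ← Matrix.exists_mulVec_eq_zero_iff]
  simp only [Matrix.sub_mulVec, Matrix.scalar_apply, sub_eq_zero]
  simp only [← Matrix.smul_one_eq_diagonal, Matrix.smul_mulVec, Matrix.one_mulVec,
    eq_comm (a := r • _)]

/-- A positive eigenvector of a matrix with nonnegative off-diagonal entries belongs to the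
largest real eigenvalue. -/
theorem le_of_isRoot_charpoly_of_pos {A : Matrix n n ℝ} (hA : ∀ i j, i ≠ j → 0 ≤ A i j)
    {d : n → ℝ} (hd : ∀ i, 0 < d i) {x : ℝ} (hx : A.mulVec d = x • d) {r : ℝ}
    (hr : A.charpoly.IsRoot r) : r ≤ x := by
  obtain ⟨w, hw0, hw⟩ := (isRoot_charpoly_iff_exists_mulVec A r).1 hr
  obtain ⟨i₁, hi₁⟩ := Function.ne_iff.1 hw0
  have : Nonempty n := ⟨i₁⟩
  -- At an index maximizing `|w i| / d i`, row `i` of the eigenvalue equation for `w` is dominated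
  -- by that for `d`.
  obtain ⟨i, hi⟩ := Finite.exists_max fun i => |w i| / d i
  have hpos : 0 < |w i| / d i := (div_pos (abs_pos.2 hi₁) (hd i₁)).trans_le (hi i₁)
  set ρ := |w i| / d i with hρ
  have hwi : |w i| = ρ * d i := by rw [hρ, div_mul_cancel₀ _ (hd i).ne']
  have hle (j : n) : |w j| ≤ ρ * d j := (div_le_iff₀ (hd j)).1 (hi j)
  have h1 := congrFun hw i
  have h2 := congrFun hx i
  simp only [Matrix.mulVec, dotProduct, Pi.smul_apply, smul_eq_mul] at h1 h2
  rw [← Finset.add_sum_erase _ _ (Finset.mem_univ i)] at h1 h2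
  have h3 : |(r - A i i) * w i| ≤ ∑ j ∈ Finset.univ.erase i, A i j * (ρ * d j) := by
    rw [show (r - A i i) * w i = ∑ j ∈ Finset.univ.erase i, A i j * w j by linarith]
    refine (Finset.abs_sum_le_sum_abs _ _).trans (Finset.sum_le_sum fun j hj => ?_)
    have := hA i j (Finset.ne_of_mem_erase hj).symm
    rw [abs_mul, abs_of_nonneg this]
    exact mul_le_mul_of_nonneg_left (hle j) this
  have h4 : ∑ j ∈ Finset.univ.erase i, A i j * (ρ * d j) = (x - A i i) * |w i| := by
    rw [hwi, Finset.sum_congr rfl fun j _ => mul_left_comm (A i j) ρ (d j), ← Finset.mul_sum]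
    linear_combination ρ * h2
  rw [h4, abs_mul] at h3
  have h5 := le_of_mul_le_mul_right h3 (hwi ▸ mul_pos hpos (hd i))
  linarith [le_abs_self (r - A i i)]

end Perron

/-! ### The spectrum of `T`. -/

theorem sum_ite_val_eq {M : Type*} [AddCommMonoid M] (n a : ℕ) (F : ℕ → M) :
    (∑ j : Fin n, if (j : ℕ) = a then F j else 0) = if a < n then F a else 0 := by
  rw [Fin.sum_univ_eq_sum_range (fun j => if j = a then F j else 0) n, Finset.sum_ite_eq']
  simp

/-- The matrix of the action of `T(k, m + 2, c)` on differences of consecutive coordinates. -/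
def diffMatrix (m : ℕ) (k c : ℝ) : Matrix (Fin (m + 1)) (Fin (m + 1)) ℝ :=
  Matrix.of fun i j =>
    (if (j : ℕ) + 1 = i then 1 else 0) + (if (i : ℕ) + 1 = j then k - 1 else 0) +
      (if (i : ℕ) = j then (if (i : ℕ) = 0 then -1 else 0) + (if (i : ℕ) = m then 1 - c else 0)
        else 0)

theorem diffMatrix_mulVec_diffSeq (m : ℕ) (k c x : ℝ)
    (hx : diffSeq k c x (m + 1) + diffSeq k c x m = 0) :
    (diffMatrix m k c).mulVec (fun j => diffSeq k c x (m - j)) =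
      x • fun j : Fin (m + 1) => diffSeq k c x (m - j) := by
  ext i
  obtain ⟨i, hi⟩ := i
  simp only [Matrix.mulVec, dotProduct, diffMatrix, Matrix.of_apply, add_mul, ite_mul, zero_mul,
    one_mul, Finset.sum_add_distrib, Pi.smul_apply, smul_eq_mul]
  have e1 := sum_ite_val_eq (m + 1) (i + 1) fun j => (k - 1) * diffSeq k c x (m - j)
  have e2 := sum_ite_val_eq (m + 1) i fun j =>
    (if i = 0 then -diffSeq k c x (m - j) else 0) +
      (if i = m then (1 - c) * diffSeq k c x (m - j) else 0)
  simp only [eq_comm (b := i + 1), eq_comm (b := i), neg_mul, one_mul] at e1 e2 ⊢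
  rw [e1, e2]
  rcases i with _ | i
  · rcases m with _ | m
    · simp [diffSeq] at hx ⊢
      linarith
    · simp [diffSeq] at hx ⊢
      linarith
  · have e3 := sum_ite_val_eq (m + 1) i fun j => diffSeq k c x (m - j)
    simp only [eq_comm (b := i), Nat.add_right_cancel_iff] at e3 ⊢
    rw [e3]
    obtain ⟨l, rfl⟩ : ∃ l, m = i + 1 + l := ⟨m - (i + 1), by omega⟩
    rcases l with _ | l
    · simp [diffSeq]
    · have h1 : i + 1 + (l + 1) - i = l + 2 := by omega
      have h2 : i + 1 + (l + 1) - (i + 1) = l + 1 := by omega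
      have h3 : i + 1 + (l + 1) - (i + 1 + 1) = l := by omega
      rw [h1, h2, h3, if_pos (by omega), if_pos (by omega), if_pos (by omega), if_neg (by omega),
        if_neg (by omega), diffSeq]
      ring

/-- The change of coordinates to the first coordinate and the differences of consecutive ones. -/
def diffBasis (m : ℕ) : Matrix (Fin (m + 2)) (Fin (m + 2)) ℝ :=
  Matrix.of fun i j =>
    Fin.cases (if j = 0 then 1 else 0)
      (fun i => (if i.castSucc = j then 1 else 0) - (if i.succ = j then 1 else 0)) i

/-- `T(k, m + 2, c)` in the coordinates given by `diffBasis`. -/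
def diffBlock (m : ℕ) (k c : ℝ) : Matrix (Fin (m + 2)) (Fin (m + 2)) ℝ :=
  Matrix.of fun i j =>
    Fin.cases (Fin.cases k (fun j => if j = 0 then -k else 0) j)
      (fun i => Fin.cases 0 (fun j => diffMatrix m k c i j) j) i

theorem isUnit_diffBasis (m : ℕ) : IsUnit (diffBasis m) := by
  rw [Matrix.isUnit_iff_isUnit_det, Matrix.det_of_isLowerTriangular]
  · refine isUnit_iff_ne_zero.2 (Finset.prod_ne_zero_iff.2 fun i _ => ?_)
    refine Fin.cases ?_ (fun i => ?_) i
    · simp [diffBasis]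
    · simp [diffBasis, Fin.castSucc_lt_succ.ne]
  · intro i j h
    have h : i < j := h
    revert h
    refine Fin.cases (fun h => ?_) (fun i h => ?_) i
    · simp [diffBasis, h.ne']
    · have h1 : i.succ ≠ j := h.ne
      have h2 : i.castSucc ≠ j := (i.castSucc_lt_succ.trans h).ne
      simp [diffBasis, h1, h2]

theorem charpoly_diffBlock (m : ℕ) (k c : ℝ) :
    (diffBlock m k c).charpoly =
      (Polynomial.X - Polynomial.C k) * (diffMatrix m k c).charpoly := by
  rw [Matrix.charpoly, Matrix.det_succ_column_zero, Fin.sum_univ_succ, Finset.sum_eq_zero]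
  · have : (diffBlock m k c).charmatrix.submatrix (Fin.succAbove 0) Fin.succ =
        (diffMatrix m k c).charmatrix := by
      ext i j : 2
      simp [Matrix.charmatrix_apply, diffBlock, Matrix.diagonal_apply]
    rw [this, Matrix.charpoly]
    simp [diffBlock]
  · intro i _
    simp [diffBlock]

/-- Constant row sums make constant vectors eigenvectors, so the differences of the image depend
only on the differences of the argument; hence the block triangular shape. -/
theorem diffBasis_mul_T (m k : ℕ) (c : ℝ) :
    diffBasis m * T k (m + 2) c = diffBlock m k c * diffBasis m := by
  ext i j
  rw [Matrix.mul_apply, Matrix.mul_apply, Fin.sum_univ_succ (n := m + 1) (f := fun l =>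
    diffBlock m k c i l * diffBasis m l j)]
  refine Fin.cases ?_ (fun i => ?_) i
  · simp only [diffBasis, diffBlock, Matrix.of_apply, Fin.cases_zero, Fin.cases_succ, ite_mul,
      one_mul, zero_mul, Finset.sum_ite_eq', Finset.mem_univ, if_true]
    obtain ⟨j, hj⟩ := j
    rcases j with _ | _ | j <;>
      simp only [T, upperEntry, Matrix.of_apply, Fin.ext_iff, Fin.val_zero, Fin.val_succ] <;> simp
  · simp only [diffBasis, diffBlock, Matrix.of_apply, Fin.cases_zero, Fin.cases_succ, sub_mul,
      ite_mul, one_mul, zero_mul, mul_ite, mul_one, mul_sub, mul_zero, Finset.sum_sub_distrib,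
      Finset.sum_ite_eq, Finset.mem_univ, if_true]
    obtain ⟨i, hi⟩ := i
    obtain ⟨j, hj⟩ := j
    simp only [diffMatrix, Matrix.of_apply, ← Fin.val_inj, Fin.val_castSucc, Fin.val_succ]
    have e1 := sum_ite_val_eq (m + 1) j fun x =>
      ((if x + 1 = i then 1 else 0) + if i + 1 = x then (k : ℝ) - 1 else 0) +
        if i = x then (if i = 0 then -1 else 0) + if i = m then 1 - c else 0 else 0
    rw [e1]
    rcases j with _ | j
    · simp only [T, upperEntry, lowerEntry, Matrix.of_apply, Fin.ext_iff, Fin.val_succ,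
        Fin.val_castSucc]
      rcases i with _ | _ | i <;> simp <;> grind
    · have e2 := sum_ite_val_eq (m + 1) j fun x =>
        ((if x + 1 = i then 1 else 0) + if i + 1 = x then (k : ℝ) - 1 else 0) +
          if i = x then (if i = 0 then -1 else 0) + if i = m then 1 - c else 0 else 0
      simp only [Nat.add_right_cancel_iff]
      rw [e2]
      simp only [T, upperEntry, lowerEntry, Matrix.of_apply, Fin.ext_iff, Fin.val_succ,
        Fin.val_castSucc]
      grind

/-- The second largest eigenvalue of `T(k, m + 2, c)` is the zero of the last continuant at which
all the preceding ones are positive. -/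
theorem secondLargestEigenvalue_T {k : ℕ} (hk : 2 ≤ k) {c : ℝ}
    {m : ℕ} {x : ℝ} (hx : ∀ i ≤ m, 0 < diffSeq k c x i)
    (h0 : diffSeq k c x (m + 1) + diffSeq k c x m = 0) (hxk : x < k) :
    secondLargestEigenvalue (T k (m + 2) c) = x := by
  have hk' : (2 : ℝ) ≤ k := by exact_mod_cast hk
  set S := diffMatrix m k c with hS
  have hSd := diffMatrix_mulVec_diffSeq m k c x h0
  have hle (r : ℝ) (hr : r ∈ S.charpoly.roots) : r ≤ x := by
    refine le_of_isRoot_charpoly_of_pos (fun i j hij => ?_)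
      (fun j : Fin (m + 1) => hx (m - j) (Nat.sub_le _ _)) hSd (Polynomial.isRoot_of_mem_roots hr)
    have : (i : ℕ) ≠ j := fun h => hij (Fin.ext h)
    simp only [diffMatrix, Matrix.of_apply, if_neg this, add_zero]
    split_ifs <;> linarith
  have hroot : x ∈ S.charpoly.roots := by
    rw [Polynomial.mem_roots S.charpoly_monic.ne_zero, isRoot_charpoly_iff_exists_mulVec]
    exact ⟨_, fun h => (hx _ (Nat.sub_le m 0)).ne' (congrFun h 0), hSd⟩
  obtain ⟨u, hu⟩ := isUnit_diffBasis m
  have hconj : (T k (m + 2) c).charpoly =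
      (Polynomial.X - Polynomial.C (k : ℝ)) * S.charpoly := by
    rw [← charpoly_diffBlock, ← Matrix.charpoly_units_conj u, hu, diffBasis_mul_T, ← hu, mul_assoc,
      ← Matrix.coe_units_inv, Units.mul_inv, mul_one]
  obtain ⟨R, hR⟩ := Multiset.exists_cons_of_mem hroot
  -- The sorted list of roots starts with `k`, then `x`, because `x` bounds all roots of `S` and `x
  -- < k`.
  rw [secondLargestEigenvalue, hconj, Polynomial.roots_mul (mul_ne_zero
    (Polynomial.X_sub_C_ne_zero _) S.charpoly_monic.ne_zero), Polynomial.roots_X_sub_C,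
    Multiset.singleton_add, Multiset.sort_cons _ _ _ fun b hb => (hle b hb).trans hxk.le, hR,
    Multiset.sort_cons _ _ _ fun b hb => hle b (hR ▸ Multiset.mem_cons_of_mem hb)]
  simp

/-! ### The key identity for sequences with the non-backtracking recurrence. -/

section Recurrence

variable {E : Type*} [AddCommGroup E] [Module ℝ E]

/-- The combination of the first `m + 1` terms of `N` with coefficients `partialSeq`. -/
def partialComb (k c x : ℝ) (N : ℕ → E) (m : ℕ) : E :=
  ∑ i ∈ Finset.range (m + 1), partialSeq k c x (m - i) • N i

theorem partialComb_add_two (k c x : ℝ) (N : ℕ → E) (m : ℕ) :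
    partialComb k c x N (m + 2) = x • partialComb k c x N (m + 1) - (k - 1) • partialComb k c x N m
      + (c • ∑ i ∈ Finset.range (m + 2), N i + N (m + 2)) := by
  have h : ∑ i ∈ Finset.range (m + 1), partialSeq k c x (m + 2 - i) • N i =
      x • ∑ i ∈ Finset.range (m + 1), partialSeq k c x (m + 1 - i) • N i
        - (k - 1) • ∑ i ∈ Finset.range (m + 1), partialSeq k c x (m - i) • N i
        + c • ∑ i ∈ Finset.range (m + 1), N i := by
    simp only [Finset.smul_sum, ← Finset.sum_sub_distrib, ← Finset.sum_add_distrib]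
    refine Finset.sum_congr rfl fun i hi => ?_
    obtain ⟨l, rfl⟩ : ∃ l, m = i + l := ⟨m - i, by have := Finset.mem_range.1 hi; omega⟩
    rw [show i + l + 2 - i = l + 2 by omega, show i + l + 1 - i = l + 1 by omega,
      show i + l - i = l by omega, partialSeq_add_two]
    module
  simp only [partialComb]
  rw [Finset.sum_range_succ, Finset.sum_range_succ, h,
    Finset.sum_range_succ (fun i => partialSeq k c x (m + 1 - i) • N i) (m + 1),
    Finset.sum_range_succ N (m + 1), Nat.sub_self, Nat.sub_self,
    show m + 2 - (m + 1) = 1 by omega, partialSeq_zero, partialSeq_one]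
  module

/-- Stated for an abstract linear map so that it applies both to multiplication by `A` on matrices
and to multiplication by `k` on their row sums. -/
theorem apply_partialComb {k c x : ℝ} {N : ℕ → E} {L : E →ₗ[ℝ] E} (h0 : L (N 0) = N 1)
    (h1 : L (N 1) = N 2 + k • N 0) (h2 : ∀ i, L (N (i + 2)) = N (i + 3) + (k - 1) • N (i + 1))
    {m : ℕ} (hx : diffSeq k c x (m + 1) + diffSeq k c x m = 0) :
    L (partialComb k c x N m) = x • partialComb k c x N m
      + (c • ∑ i ∈ Finset.range (m + 1), N i + N (m + 1)) := by
  rcases m with _ | m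
  · simp only [diffSeq] at hx
    obtain rfl : c = -x := by linarith
    simp [partialComb, partialSeq_zero, h0]
  -- The choice of `x` enters here: this equality absorbs the surplus `N 0` in `L (N 1)`, where `k`
  -- stands in place of `k - 1`.
  have hp : partialSeq k c x (m + 2) = partialSeq k c x m := by
    rw [partialSeq_succ, partialSeq_succ]
    linarith
  have h : L (partialComb k c x N (m + 1)) =
      partialComb k c x N (m + 2) + (k - 1) • partialComb k c x N m := by
    simp only [partialComb]
    rw [Finset.sum_range_succ', Finset.sum_range_succ', Finset.sum_range_succ' _ (m + 2),
      Finset.sum_range_succ' _ (m + 1), Finset.sum_range_succ' _ m, Finset.sum_range_succ' _ m]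
    simp only [map_add, map_sum, map_smul, zero_add, h0, h1, h2, smul_add, Finset.sum_add_distrib,
      Nat.add_assoc, Nat.reduceAdd, Nat.sub_zero, Nat.add_sub_add_right, hp, Finset.smul_sum,
      smul_comm (k - 1)]
    have e0 (i : ℕ) : m - (i + 1) = m + 1 - (i + 2) := by omega
    have e1 : m + 1 - 1 = m := by omega
    have e2 : m + 2 - 1 = m + 1 := by omega
    have e3 : m + 2 - 2 = m := by omega
    simp only [e0, e1, e2, e3]
    module
  rw [h, partialComb_add_two]
  module

end Recurrence

/-! ### Layer sizes of the regular tree and the trivial eigenvalue. -/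

/-- The number of vertices at distance `n` from a vertex of the `k`-regular tree. -/
def treeLayer (k : ℝ) : ℕ → ℝ
  | 0 => 1
  | n + 1 => k * (k - 1) ^ n

theorem mul_treeLayer_one (k : ℝ) : k * treeLayer k 1 = treeLayer k 2 + k * treeLayer k 0 := by
  simp only [treeLayer]
  ring

theorem mul_treeLayer_add_two (k : ℝ) (i : ℕ) :
    k * treeLayer k (i + 2) = treeLayer k (i + 3) + (k - 1) * treeLayer k (i + 1) := by
  simp only [treeLayer]
  ring

theorem treeLayer_pos {k : ℝ} (hk : 2 ≤ k) (n : ℕ) : 0 < treeLayer k n := by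
  have : 0 < k - 1 := by linarith
  have : 0 < k := by linarith
  cases n <;> simp only [treeLayer] <;> positivity

theorem mul_M (k m : ℕ) {c : ℝ} (hc : 0 < c) :
    c * M k (m + 2) c =
      c * ∑ i ∈ Finset.range (m + 1), treeLayer k i + treeLayer k (m + 1) := by
  rw [M, Finset.sum_range_succ', Nat.add_sub_cancel]
  simp only [treeLayer]
  field_simp
  ring

/-- The key identity read on row sums. It brings `M` into the bound, and since the other factors are
positive it also yields `x < k`. -/
theorem sub_mul_partialComb_treeLayer {k m : ℕ} {c x : ℝ} (hc : 0 < c)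
    (hx : diffSeq k c x (m + 1) + diffSeq k c x m = 0) :
    (k - x) * partialComb k c x (treeLayer k) m = c * M k (m + 2) c := by
  have := apply_partialComb (N := treeLayer k) (L := LinearMap.mulLeft ℝ (k : ℝ))
    (by simp [treeLayer]) (mul_treeLayer_one k) (mul_treeLayer_add_two k) hx
  rw [mul_M k m hc]
  simp only [LinearMap.mulLeft_apply, smul_eq_mul] at this
  linarith

theorem partialSeq_pos {k c x : ℝ} {m : ℕ} (hx : ∀ i ≤ m, 0 < diffSeq k c x i) {i : ℕ}
    (hi : i ≤ m) : 0 < partialSeq k c x i :=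
  Finset.sum_pos (fun j hj => hx j (by have := Finset.mem_range.1 hj; omega)) (by simp)

theorem partialComb_treeLayer_pos {k c x : ℝ} (hk : 2 ≤ k) {m : ℕ}
    (hx : ∀ i ≤ m, 0 < diffSeq k c x i) : 0 < partialComb k c x (treeLayer k) m :=
  Finset.sum_pos (fun i _ => mul_pos (partialSeq_pos hx (Nat.sub_le m i)) (treeLayer_pos hk i))
    (by simp)

theorem M_pos {k : ℕ} (hk : 2 ≤ k) (m : ℕ) {c : ℝ} (hc : 0 < c) : 0 < M k (m + 2) c := by
  have hk' : (2 : ℝ) ≤ k := by exact_mod_cast hk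
  refine pos_of_mul_pos_right (a := c) ?_ hc.le
  rw [mul_M k m hc]
  have := Finset.sum_pos (s := Finset.range (m + 1)) (fun i _ => treeLayer_pos hk' i) (by simp)
  have := treeLayer_pos hk' (m + 1)
  positivity

/-! ### Matrices of non-backtracking walks. -/

section NonBacktracking

variable {V : Type*} [Fintype V] [DecidableEq V] (G : SimpleGraph V) [DecidableRel G.Adj]

/-- The number of non-backtracking walks of length `n` from `x` to `y` whose first step does not
lead to `p`. -/
def nbWalksAvoiding : ℕ → V → V → V → ℕ
  | 0, _, x, y => if x = y then 1 else 0
  | n + 1, p, x, y => ∑ z ∈ (G.neighborFinset x).erase p, nbWalksAvoiding n x z y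

/-- The number of non-backtracking walks of length `n` from `x` to `y`. -/
def nbWalks : ℕ → V → V → ℕ
  | 0, x, y => if x = y then 1 else 0
  | n + 1, x, y => ∑ z ∈ G.neighborFinset x, nbWalksAvoiding G n x z y

/-- The matrix of the numbers of non-backtracking walks of length `n`. -/
def nbMatrix (n : ℕ) : Matrix V V ℝ := Matrix.of fun x y => (nbWalks G n x y : ℝ)

theorem nbWalksAvoiding_succ_add {p x : V} (h : G.Adj x p) (n : ℕ) (y : V) :
    nbWalksAvoiding G (n + 1) p x y + nbWalksAvoiding G n x p y = nbWalks G (n + 1) x y :=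
  Finset.sum_erase_add _ _ (by simpa using h)

variable {G} {k : ℕ}

theorem nbMatrix_zero : nbMatrix G 0 = 1 := by
  ext x y
  simp [nbMatrix, nbWalks, Matrix.one_apply]

theorem nbMatrix_one : nbMatrix G 1 = G.adjMatrix ℝ := by
  ext x y
  simp [nbMatrix, nbWalks, nbWalksAvoiding, SimpleGraph.adjMatrix_apply]

/-- A walk from a neighbour `z` of `x` either extends backwards to a non-backtracking walk from `x`,
or starts by stepping to `x`; the second sum counts what remains after that step. -/
theorem sum_nbWalks_succ (n : ℕ) (x y : V) :
    ∑ z ∈ G.neighborFinset x, nbWalks G (n + 1) z y =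
      nbWalks G (n + 2) x y + ∑ z ∈ G.neighborFinset x, nbWalksAvoiding G n z x y := by
  rw [nbWalks, ← Finset.sum_add_distrib]
  refine Finset.sum_congr rfl fun z hz => ?_
  exact (nbWalksAvoiding_succ_add G (by simpa using ((G.mem_neighborFinset _ _).1 hz).symm) n y).symm

theorem adjMatrix_mul_nbMatrix_one (hG : G.IsRegularOfDegree k) :
    G.adjMatrix ℝ * nbMatrix G 1 = nbMatrix G 2 + (k : ℝ) • nbMatrix G 0 := by
  ext x y
  rw [SimpleGraph.adjMatrix_mul_apply]
  simp only [nbMatrix, Matrix.of_apply, Matrix.add_apply, Matrix.smul_apply, smul_eq_mul]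
  have := sum_nbWalks_succ (G := G) 0 x y
  have h2 : ∑ z ∈ G.neighborFinset x, nbWalksAvoiding G 0 z x y = k * nbWalks G 0 x y := by
    simp [nbWalksAvoiding, nbWalks, hG.degree_eq]
  rw [h2] at this
  exact_mod_cast this

theorem adjMatrix_mul_nbMatrix_add_two (hG : G.IsRegularOfDegree k) (n : ℕ) :
    G.adjMatrix ℝ * nbMatrix G (n + 2) =
      nbMatrix G (n + 3) + ((k : ℝ) - 1) • nbMatrix G (n + 1) := by
  ext x y
  rw [SimpleGraph.adjMatrix_mul_apply]
  simp only [nbMatrix, Matrix.of_apply, Matrix.add_apply, Matrix.smul_apply, smul_eq_mul]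
  have h1 := sum_nbWalks_succ (G := G) (n + 1) x y
  -- Each walk from `x` avoids all neighbours of `x` as first step except one, so it is counted `k -
  -- 1` times.
  have h2 : ∑ z ∈ G.neighborFinset x, nbWalksAvoiding G (n + 1) z x y + nbWalks G (n + 1) x y =
      k * nbWalks G (n + 1) x y := by
    conv_lhs => rw [nbWalks]
    rw [← Finset.sum_add_distrib, Finset.sum_congr rfl fun z hz =>
      nbWalksAvoiding_succ_add G ((G.mem_neighborFinset _ _).1 hz) n y]
    simp [hG.degree_eq]
  have h1' : ∑ z ∈ G.neighborFinset x, (nbWalks G (n + 2) z y : ℝ) = nbWalks G (n + 3) x y +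
      ∑ z ∈ G.neighborFinset x, (nbWalksAvoiding G (n + 1) z x y : ℝ) := by exact_mod_cast h1
  have h2' : ∑ z ∈ G.neighborFinset x, (nbWalksAvoiding G (n + 1) z x y : ℝ) +
      nbWalks G (n + 1) x y = k * nbWalks G (n + 1) x y := by exact_mod_cast h2
  linarith

/-- Induction along the recurrence of the matrices `nbMatrix G n`. -/
theorem nbMatrix_induction (hG : G.IsRegularOfDegree k) {P : ℕ → Matrix V V ℝ → Prop}
    (h0 : P 0 1) (h1 : P 1 (G.adjMatrix ℝ))
    (h2 : P 0 1 → P 1 (G.adjMatrix ℝ) →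
      P 2 (G.adjMatrix ℝ * nbMatrix G 1 - (k : ℝ) • 1))
    (h3 : ∀ n, P (n + 1) (nbMatrix G (n + 1)) → P (n + 2) (nbMatrix G (n + 2)) →
      P (n + 3) (G.adjMatrix ℝ * nbMatrix G (n + 2) - ((k : ℝ) - 1) • nbMatrix G (n + 1)))
    (n : ℕ) : P n (nbMatrix G n) := by
  have e2 : nbMatrix G 2 = G.adjMatrix ℝ * nbMatrix G 1 - (k : ℝ) • 1 := by
    rw [adjMatrix_mul_nbMatrix_one hG, nbMatrix_zero, add_sub_cancel_right]
  have key (n : ℕ) : P (n + 1) (nbMatrix G (n + 1)) ∧ P (n + 2) (nbMatrix G (n + 2)) := by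
    induction n with
    | zero => exact ⟨nbMatrix_one (G := G) ▸ h1, e2 ▸ h2 h0 h1⟩
    | succ n ih =>
      refine ⟨ih.2, ?_⟩
      have := h3 n ih.1 ih.2
      rwa [adjMatrix_mul_nbMatrix_add_two hG, add_sub_cancel_right] at this
  rcases n with _ | n
  · exact nbMatrix_zero (G := G) ▸ h0
  · exact (key n).1

theorem commute_adjMatrix_nbMatrix (hG : G.IsRegularOfDegree k) (n : ℕ) :
    Commute (G.adjMatrix ℝ) (nbMatrix G n) := by
  refine nbMatrix_induction hG (P := fun _ N => Commute (G.adjMatrix ℝ) N) (Commute.one_right _)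
    (Commute.refl _) (fun _ h1 => ?_) (fun n h1 h2 => ?_) n
  · rw [nbMatrix_one]
    exact (h1.mul_right h1).sub_right ((Commute.one_right _).smul_right _)
  · exact ((Commute.refl _).mul_right h2).sub_right (h1.smul_right _)

theorem transpose_nbMatrix (hG : G.IsRegularOfDegree k) (n : ℕ) :
    (nbMatrix G n).transpose = nbMatrix G n := by
  refine nbMatrix_induction hG (P := fun _ N => N.transpose = N) (by simp) (by simp)
    (fun _ _ => ?_) (fun n h1 h2 => ?_) n
  · rw [nbMatrix_one]
    simp
  · rw [Matrix.transpose_sub, Matrix.transpose_mul, Matrix.transpose_smul, h1, h2,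
      SimpleGraph.transpose_adjMatrix, (commute_adjMatrix_nbMatrix hG (n + 2)).eq]

theorem nbMatrix_mulVec_one (hG : G.IsRegularOfDegree k) (n : ℕ) :
    (nbMatrix G n).mulVec 1 = treeLayer k n • 1 := by
  have hA : (G.adjMatrix ℝ).mulVec 1 = (k : ℝ) • 1 := by
    ext x
    simp [SimpleGraph.adjMatrix_mulVec_apply, hG.degree_eq]
  refine nbMatrix_induction hG (P := fun n N => N.mulVec 1 = treeLayer k n • 1) (by simp [treeLayer])
    (by simp [treeLayer, hA]) (fun _ _ => ?_) (fun n h1 h2 => ?_) n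
  · rw [nbMatrix_one, Matrix.sub_mulVec, ← Matrix.mulVec_mulVec, hA, Matrix.mulVec_smul, hA,
      Matrix.smul_mulVec, Matrix.one_mulVec, smul_smul, ← sub_smul]
    congr 1
    simp only [treeLayer]
    ring
  · rw [Matrix.sub_mulVec, ← Matrix.mulVec_mulVec, h2, Matrix.mulVec_smul, hA,
      Matrix.smul_mulVec, h1, smul_smul, smul_smul, ← sub_smul]
    congr 1
    linear_combination mul_treeLayer_add_two k n

/-- In the recurrence the subtracted term vanishes at distance `n` or more, so both claims pass
through multiplication by the adjacency matrix. -/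
theorem nbMatrix_apply_eq_zero_of_lt_dist (hG : G.IsRegularOfDegree k) (hc : G.Connected)
    (n : ℕ) : (∀ x y, n < G.dist x y → nbMatrix G n x y = 0) ∧
      ∀ x y, n = G.dist x y → 0 < nbMatrix G n x y := by
  have hstep {n : ℕ} {N : Matrix V V ℝ} (h : ∀ x y, n < G.dist x y → N x y = 0) (x y : V)
      (hxy : n + 1 < G.dist x y) : (G.adjMatrix ℝ * N) x y = 0 := by
    rw [SimpleGraph.adjMatrix_mul_apply]
    refine Finset.sum_eq_zero fun z hz => h z y ?_
    have h1 := hc.dist_triangle (u := x) (v := z) (w := y)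
    rw [SimpleGraph.dist_eq_one_iff_adj.2 ((G.mem_neighborFinset _ _).1 hz)] at h1
    omega
  have hstep' {n : ℕ} {N : Matrix V V ℝ} (h0 : ∀ x y, 0 ≤ N x y)
      (h : ∀ x y, n = G.dist x y → 0 < N x y) (x y : V) (hxy : n + 1 = G.dist x y) :
      0 < (G.adjMatrix ℝ * N) x y := by
    rw [SimpleGraph.adjMatrix_mul_apply]
    obtain ⟨w, hw⟩ := hc.exists_walk_length_eq_dist x y
    cases w with
    | nil => simp at hxy
    | @cons _ z _ hxz w =>
      refine Finset.sum_pos' (fun z _ => h0 z y) ⟨z, by simpa using hxz, h z y ?_⟩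
      have h1 := hc.dist_triangle (u := x) (v := z) (w := y)
      rw [SimpleGraph.dist_eq_one_iff_adj.2 hxz] at h1
      have h2 := SimpleGraph.dist_le w
      rw [SimpleGraph.Walk.length_cons] at hw
      omega
  have hnn (n : ℕ) (x y : V) : 0 ≤ nbMatrix G n x y := Nat.cast_nonneg _
  have hone (x y : V) (h : 0 < G.dist x y) : (1 : Matrix V V ℝ) x y = 0 := by
    refine Matrix.one_apply_ne fun hxy => ?_
    simp [hxy] at h
  have hadj (x y : V) (h : 1 < G.dist x y) : G.adjMatrix ℝ x y = 0 := by
    rw [SimpleGraph.adjMatrix_apply, if_neg]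
    intro hxy
    rw [SimpleGraph.dist_eq_one_iff_adj.2 hxy] at h
    omega
  have hadj' (x y : V) (h : 1 = G.dist x y) : 0 < G.adjMatrix ℝ x y := by
    rw [SimpleGraph.adjMatrix_apply, if_pos (SimpleGraph.dist_eq_one_iff_adj.1 h.symm)]
    exact one_pos
  refine nbMatrix_induction hG (P := fun n N => (∀ x y, n < G.dist x y → N x y = 0) ∧
    ∀ x y, n = G.dist x y → 0 < N x y) ⟨hone, fun x y h => ?_⟩ ⟨hadj, hadj'⟩
    (fun h0 h1 => ⟨fun x y h => ?_, fun x y h => ?_⟩)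
    (fun n h1 h2 => ⟨fun x y h => ?_, fun x y h => ?_⟩) n
  · rw [(hc.dist_eq_zero_iff).1 h.symm]
    simp
  · rw [nbMatrix_one, Matrix.sub_apply, hstep h1.1 x y h, Matrix.smul_apply,
      hone x y (by omega)]
    simp
  · rw [nbMatrix_one, Matrix.sub_apply, Matrix.smul_apply, hone x y (by omega)]
    simpa using hstep' (nbMatrix_one (G := G) ▸ hnn 1) h1.2 x y h
  · rw [Matrix.sub_apply, hstep h2.1 x y h, Matrix.smul_apply, h1.1 x y (by omega)]
    simp
  · rw [Matrix.sub_apply, Matrix.smul_apply, h1.1 x y (by omega)]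
    simpa using hstep' (hnn _) h2.2 x y h

end NonBacktracking

/-! ### Positive semidefiniteness from the second eigenvalue. -/

section Spectral

variable {V : Type*} [Fintype V]

theorem dotProduct_mulVec_nonneg_of_orthonormalBasis
    (b : OrthonormalBasis V ℝ (EuclideanSpace ℝ V)) {A : Matrix V V ℝ} {r : V → ℝ}
    (hr : ∀ i, 0 ≤ r i) (hA : ∀ i, A.mulVec (b i).ofLp = r i • (b i).ofLp) (v : V → ℝ) :
    0 ≤ v ⬝ᵥ A.mulVec v := by
  have hv : v = ∑ i, (v ⬝ᵥ (b i).ofLp) • (b i).ofLp := by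
    have := congrArg WithLp.ofLp (b.sum_repr (WithLp.toLp 2 v))
    simpa [b.repr_apply_apply, EuclideanSpace.inner_eq_star_dotProduct] using this.symm
  have h : A.mulVec v = ∑ i, (r i * (v ⬝ᵥ (b i).ofLp)) • (b i).ofLp := by
    conv_lhs => rw [hv]
    rw [Matrix.mulVec_sum]
    refine Finset.sum_congr rfl fun i _ => ?_
    rw [Matrix.mulVec_smul, hA, smul_smul, mul_comm]
  rw [h, dotProduct_sum]
  refine Finset.sum_nonneg fun i _ => ?_
  rw [dotProduct_smul, smul_eq_mul, mul_assoc]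
  exact mul_nonneg (hr i) (mul_self_nonneg _)

variable [DecidableEq V]

theorem exists_forall_ne_eigenvalues_le [Nonempty V] {A : Matrix V V ℝ} (hA : A.IsHermitian) :
    ∃ i₀, ∀ i ≠ i₀, hA.eigenvalues i ≤ secondLargestEigenvalue A := by
  set e := (Fintype.equivOfCardEq (Fintype.card_fin (Fintype.card V)) : _ ≃ V) with he
  refine ⟨e ⟨0, Fintype.card_pos⟩, fun i hi => ?_⟩
  have hi0 : (e.symm i : ℕ) ≠ 0 := fun h => hi (by
    rw [← e.apply_symm_apply i]
    exact congrArg e (Fin.ext h))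
  have hcard : 1 < Fintype.card V := by have := (e.symm i).2; omega
  have hs : secondLargestEigenvalue A = hA.eigenvalues₀ ⟨1, hcard⟩ := by
    have := hA.sort_roots_charpoly_eq_eigenvalues₀
    simp only [RCLike.re_to_real, Multiset.map_id'] at this
    rw [secondLargestEigenvalue, this, List.getD_eq_getElem _ _ (by simpa using hcard)]
    simp
  rw [hs]
  refine hA.eigenvalues₀_antitone ?_
  rw [Fin.le_def]
  change 1 ≤ (e.symm i : ℕ)
  omega

/-- If the all-one vector is an eigenvector of `A` for an eigenvalue `r` that exceeds a bound `x`
for the second largest eigenvalue, then `A ≤ x + (r - x) / |V| • J`. -/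
theorem posSemidef_of_secondLargestEigenvalue_le [Nonempty V] {A : Matrix V V ℝ}
    (hA : A.IsHermitian) {r x : ℝ} (h1 : A.mulVec 1 = r • 1) (hx : secondLargestEigenvalue A ≤ x)
    (hxr : x < r) :
    (x • (1 : Matrix V V ℝ) - A +
      ((r - x) / Fintype.card V) • Matrix.of fun _ _ => (1 : ℝ)).PosSemidef := by
  obtain ⟨i₀, hi₀⟩ := exists_forall_ne_eigenvalues_le hA
  set b := hA.eigenvectorBasis
  set J : Matrix V V ℝ := Matrix.of fun _ _ => (1 : ℝ) with hJ
  have hJv (v : V → ℝ) : J.mulVec v = (v ⬝ᵥ 1) • 1 := by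
    ext i
    simp [hJ, Matrix.mulVec, dotProduct]
  have hb (i : V) : A.mulVec (b i).ofLp = hA.eigenvalues i • (b i).ofLp :=
    hA.mulVec_eigenvectorBasis i
  have horth (i : V) (hi : i ≠ i₀) : (b i).ofLp ⬝ᵥ 1 = 0 := by
    have h2 : A.mulVec (b i).ofLp ⬝ᵥ 1 = (b i).ofLp ⬝ᵥ A.mulVec 1 := by
      rw [Matrix.dotProduct_mulVec, ← Matrix.mulVec_transpose,
        ← Matrix.conjTranspose_eq_transpose_of_trivial, hA.eq]
    rw [hb, h1, smul_dotProduct, dotProduct_smul, smul_eq_mul, smul_eq_mul] at h2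
    have h3 := hi₀ i hi
    have h4 : (hA.eigenvalues i - r) * ((b i).ofLp ⬝ᵥ 1) = 0 := by linarith
    -- Here `x < r` separates the eigenvalue from `r`. So the all-one vector is orthogonal to all
    -- basis vectors but `b i₀`, without knowing beforehand that `r` is the largest eigenvalue.
    exact (mul_eq_zero.1 h4).resolve_left (by linarith)
  have hone : (1 : V → ℝ) = ((b i₀).ofLp ⬝ᵥ 1) • (b i₀).ofLp := by
    have := congrArg WithLp.ofLp (b.sum_repr (WithLp.toLp 2 (1 : V → ℝ)))
    rw [Finset.sum_eq_single i₀] at this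
    · simpa [b.repr_apply_apply, EuclideanSpace.inner_eq_star_dotProduct, dotProduct_comm]
        using this.symm
    · intro i _ hi
      have := horth i hi
      rw [dotProduct_comm] at this
      simp [b.repr_apply_apply, EuclideanSpace.inner_eq_star_dotProduct, this]
    · simp
  have hcard : (Fintype.card V : ℝ) ≠ 0 := by simp
  have hP1 : (x • (1 : Matrix V V ℝ) - A + ((r - x) / Fintype.card V) • J).mulVec 1 = 0 := by
    rw [Matrix.add_mulVec, Matrix.sub_mulVec, Matrix.smul_mulVec, Matrix.smul_mulVec,
      Matrix.one_mulVec, h1, hJv, smul_smul, ← sub_smul, ← add_smul]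
    simp only [dotProduct_one, Pi.one_apply, Finset.sum_const, Finset.card_univ, nsmul_eq_mul,
      mul_one]
    rw [div_mul_cancel₀ _ hcard]
    simp
  refine Matrix.PosSemidef.of_dotProduct_mulVec_nonneg ?_ fun v => ?_
  · refine ((Matrix.isHermitian_one.smul (IsSelfAdjoint.all x)).sub hA).add
      (Matrix.IsHermitian.smul ?_ (IsSelfAdjoint.all _))
    ext i j
    simp [hJ]
  rw [star_trivial]
  refine dotProduct_mulVec_nonneg_of_orthonormalBasis b
    (r := fun i => if i = i₀ then 0 else x - hA.eigenvalues i) (fun i => ?_) (fun i => ?_) v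
  · split_ifs with h
    · exact le_rfl
    · linarith [hi₀ i h]
  · dsimp only
    split_ifs with h
    · subst h
      have hne : (b i).ofLp ⬝ᵥ 1 ≠ 0 := by
        intro h0
        rw [h0, zero_smul] at hone
        exact one_ne_zero hone
      rw [hone, Matrix.mulVec_smul] at hP1
      rw [zero_smul]
      exact (smul_eq_zero.1 hP1).resolve_left hne
    · rw [Matrix.add_mulVec, Matrix.sub_mulVec, Matrix.smul_mulVec, Matrix.smul_mulVec,
        Matrix.one_mulVec, hb, hJv, horth i h, sub_smul]
      simp

end Spectral

/-! ### The bound on the order. -/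

section Bound

variable {V : Type*} [Fintype V] [DecidableEq V] {G : SimpleGraph V} [DecidableRel G.Adj]
  {k m : ℕ} {c x : ℝ}

/-- The combination of the non-backtracking matrices that is compared with the all-one matrix. -/
def nbSum (G : SimpleGraph V) [DecidableRel G.Adj] (m : ℕ) (c : ℝ) : Matrix V V ℝ :=
  c • ∑ i ∈ Finset.range (m + 1), nbMatrix G i + nbMatrix G (m + 1)

theorem nbSum_apply (a b : V) : nbSum G m c a b =
    c * ∑ i ∈ Finset.range (m + 1), nbMatrix G i a b + nbMatrix G (m + 1) a b := by
  simp [nbSum, Matrix.sum_apply]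

theorem nbMatrix_nonneg (i : ℕ) (a b : V) : 0 ≤ nbMatrix G i a b := Nat.cast_nonneg _

theorem one_le_nbMatrix {i : ℕ} {a b : V} (h : nbMatrix G i a b ≠ 0) : 1 ≤ nbMatrix G i a b := by
  simp only [nbMatrix, Matrix.of_apply] at h ⊢
  exact_mod_cast Nat.one_le_iff_ne_zero.2 (by exact_mod_cast h)

theorem le_nbSum_apply (hc : 0 < c) {i : ℕ} (hi : i ≤ m) {a b : V} :
    c * nbMatrix G i a b ≤ nbSum G m c a b := by
  rw [nbSum_apply]
  have := Finset.single_le_sum (f := fun i => nbMatrix G i a b) (s := Finset.range (m + 1))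
    (fun i _ => nbMatrix_nonneg i a b) (Finset.mem_range.2 (Nat.lt_succ_of_le hi))
  have h2 := nbMatrix_nonneg (G := G) (m + 1) a b
  have h3 := mul_le_mul_of_nonneg_left this hc.le
  linarith

/-- Walk counts are integers: a nonzero term of the left side contains a count at least `1`, which
alone contributes `c` to `nbSum`. -/
theorem mul_partialComb_le (hc : 0 < c) (hx : ∀ i ≤ m, 0 < diffSeq k c x i) (a b : V) :
    c * partialComb k c x (nbMatrix G) m a b ≤
      partialComb k c x (nbMatrix G) m a b * nbSum G m c a b := by
  simp only [partialComb, Matrix.sum_apply, Matrix.smul_apply, smul_eq_mul, Finset.mul_sum,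
    Finset.sum_mul]
  refine Finset.sum_le_sum fun i hi => ?_
  have him : i ≤ m := Nat.lt_succ_iff.1 (Finset.mem_range.1 hi)
  have hp := partialSeq_pos hx (Nat.sub_le m i)
  by_cases h : nbMatrix G i a b = 0
  · simp [h]
  · have h1 := one_le_nbMatrix h
    have h2 := le_nbSum_apply (G := G) hc him (a := a) (b := b)
    have h3 : c ≤ nbSum G m c a b := by nlinarith
    have h4 : 0 ≤ partialSeq k c x (m - i) * nbMatrix G i a b := by positivity
    nlinarith

theorem transpose_partialComb (hG : G.IsRegularOfDegree k) :
    (partialComb k c x (nbMatrix G) m).transpose = partialComb k c x (nbMatrix G) m := by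
  simp [partialComb, Matrix.transpose_sum, transpose_nbMatrix hG]

theorem transpose_nbSum (hG : G.IsRegularOfDegree k) :
    (nbSum G m c).transpose = nbSum G m c := by
  simp [nbSum, Matrix.transpose_sum, transpose_nbMatrix hG]

theorem partialComb_nbMatrix_mulVec_one (hG : G.IsRegularOfDegree k) :
    (partialComb k c x (nbMatrix G) m).mulVec 1 = partialComb k c x (treeLayer k) m • 1 := by
  simp [partialComb, Matrix.sum_mulVec, Matrix.smul_mulVec, nbMatrix_mulVec_one hG,
    Finset.sum_smul, smul_smul]

/-- The bound on the order of the graph, and what equality means. -/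
theorem card_le_M_and_nbSum_eq (hk : 2 ≤ k) (hc : 0 < c) (hx : ∀ i ≤ m, 0 < diffSeq k c x i)
    (h0 : diffSeq k c x (m + 1) + diffSeq k c x m = 0) (hG : G.IsRegularOfDegree k) [Nonempty V]
    (hsec : secondLargestEigenvalue (G.adjMatrix ℝ) ≤ x) :
    (Fintype.card V : ℝ) ≤ M k (m + 2) c ∧
      ((Fintype.card V : ℝ) = M k (m + 2) c → ∀ a b, nbSum G m c a b = c) := by
  have hk' : (2 : ℝ) ≤ k := by exact_mod_cast hk
  have hM := M_pos hk m hc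
  have hkx := sub_mul_partialComb_treeLayer (k := k) hc h0
  have hhk := partialComb_treeLayer_pos hk' hx
  set hh := partialComb k c x (treeLayer k) m
  have hxk : x < k := sub_pos.1 (pos_of_mul_pos_left (hkx ▸ mul_pos hc hM) hhk.le)
  have hA1 : (G.adjMatrix ℝ).mulVec 1 = (k : ℝ) • 1 := by
    ext a
    simp [SimpleGraph.adjMatrix_mulVec_apply, hG.degree_eq]
  have hAH : (G.adjMatrix ℝ).IsHermitian := by
    rw [Matrix.IsHermitian, Matrix.conjTranspose_eq_transpose_of_trivial,
      SimpleGraph.transpose_adjMatrix]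
  have hP := posSemidef_of_secondLargestEigenvalue_le hAH hA1 hsec hxk
  set J : Matrix V V ℝ := Matrix.of fun _ _ => (1 : ℝ) with hJ
  set P := x • (1 : Matrix V V ℝ) - G.adjMatrix ℝ + ((k - x) / Fintype.card V) • J
  have hH1 := partialComb_nbMatrix_mulVec_one (m := m) (c := c) (x := x) hG
  have hHt := transpose_partialComb (m := m) (c := c) (x := x) hG
  have hHle := mul_partialComb_le (G := G) hc hx
  have hrec := apply_partialComb (N := nbMatrix G) (L := LinearMap.mulLeft ℝ (G.adjMatrix ℝ))
    (by simp [nbMatrix_zero, nbMatrix_one]) (adjMatrix_mul_nbMatrix_one hG)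
    (adjMatrix_mul_nbMatrix_add_two hG) h0
  set H := partialComb k c x (nbMatrix G) m
  have hsum (a : V) : ∑ b, H a b = hh := by
    have := congrFun hH1 a
    simpa [Matrix.mulVec, dotProduct] using this
  have hJH : J * H = hh • J := by
    ext a b
    rw [← hHt]
    simp [Matrix.mul_apply, hJ, hsum]
  have hcard : (0 : ℝ) < Fintype.card V := by exact_mod_cast Fintype.card_pos
  have hPH : P * H = (c * M k (m + 2) c / Fintype.card V) • J - nbSum G m c := by
    change G.adjMatrix ℝ * H = x • H + nbSum G m c at hrec
    rw [add_mul, sub_mul, hrec, smul_mul_assoc, one_mul, smul_mul_assoc, hJH, smul_smul, ← hkx]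
    rw [show (k - x) / (Fintype.card V : ℝ) * hh = (k - x) * hh / Fintype.card V by ring]
    abel
  have hpsd := hP.conjTranspose_mul_mul_same H
  rw [Matrix.conjTranspose_eq_transpose_of_trivial, hHt, mul_assoc, hPH] at hpsd
  have htr : (H * ((c * M k (m + 2) c / Fintype.card V) • J - nbSum G m c)).trace =
      c * M k (m + 2) c * hh - ∑ a, ∑ b, H a b * nbSum G m c a b := by
    simp only [Matrix.trace, Matrix.diag_apply, Matrix.mul_apply, Matrix.sub_apply,
      Matrix.smul_apply, smul_eq_mul, mul_sub, Finset.sum_sub_distrib]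
    congr 1
    · simp only [hJ, Matrix.of_apply, mul_one, ← Finset.sum_mul, hsum, Finset.sum_const,
        Finset.card_univ, nsmul_eq_mul]
      field_simp
    · refine Finset.sum_congr rfl fun a _ => Finset.sum_congr rfl fun b _ => ?_
      rw [← Matrix.transpose_apply (nbSum G m c), transpose_nbSum hG]
  have hlow : c * (Fintype.card V * hh) ≤ ∑ a, ∑ b, H a b * nbSum G m c a b := by
    calc c * (Fintype.card V * hh) = ∑ a, ∑ b, c * H a b := by
          simp only [← Finset.mul_sum, hsum, Finset.sum_const, Finset.card_univ, nsmul_eq_mul]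
      _ ≤ _ := Finset.sum_le_sum fun a _ => Finset.sum_le_sum fun b _ => hHle a b
  have hnonneg := hpsd.trace_nonneg
  constructor
  · rw [htr] at hnonneg
    have : c * hh * Fintype.card V ≤ c * hh * M k (m + 2) c := by linarith
    exact le_of_mul_le_mul_left this (mul_pos hc hhk)
  · intro heq a b
    -- At equality `H P H` is positive semidefinite of trace zero, so it vanishes; as `P` is
    -- positive semidefinite, `P H` vanishes too.
    have hz : (H * ((c * M k (m + 2) c / Fintype.card V) • J - nbSum G m c)).trace = 0 := by
      refine le_antisymm ?_ hnonneg
      rw [htr, ← heq]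
      linarith
    rw [hpsd.trace_eq_zero_iff, ← hPH] at hz
    have hPH0 : P * H = 0 := by
      refine Matrix.ext_of_mulVec_single fun i => ?_
      have e : H.mulVec (Pi.single i 1) ⬝ᵥ P.mulVec (H.mulVec (Pi.single i 1)) =
          Pi.single i 1 ⬝ᵥ (H * (P * H)).mulVec (Pi.single i 1) := by
        rw [← Matrix.mulVec_mulVec, ← Matrix.mulVec_mulVec, Matrix.dotProduct_mulVec _ H,
          ← Matrix.mulVec_transpose, hHt]
      rw [Matrix.zero_mulVec, ← Matrix.mulVec_mulVec, ← hP.dotProduct_mulVec_zero_iff,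
        star_trivial, e, hz]
      simp
    have := congrFun (congrFun (hPH.symm.trans hPH0) a) b
    rw [← heq] at this
    simp only [hJ, Matrix.sub_apply, Matrix.smul_apply, Matrix.of_apply, smul_eq_mul,
      Matrix.zero_apply, mul_one, mul_div_assoc, div_self hcard.ne'] at this
    linarith

end Bound

/-! ### Sharpness and distance-regularity. -/

theorem sum_T_row (k m : ℕ) (c : ℝ) (i : Fin (m + 2)) : ∑ j, T k (m + 2) c i j = k := by
  obtain ⟨i, hi⟩ := i
  set D : ℝ := k - (if i + 1 < m + 2 then upperEntry k i else 0)
    - (if 0 < i then lowerEntry (m + 2) c i else 0) with hD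
  have h (j : Fin (m + 2)) : T k (m + 2) c ⟨i, hi⟩ j =
      (if (j : ℕ) = i + 1 then upperEntry k i else 0) +
        (if (j : ℕ) = i then D else 0) +
        (if (j : ℕ) = i - 1 then if 0 < i then lowerEntry (m + 2) c i else 0 else 0) := by
    simp only [T, Matrix.of_apply, Fin.ext_iff, ← hD]
    obtain ⟨j, hj⟩ := j
    dsimp only
    rcases lt_trichotomy (i + 1) j with h | h | h
    · simp [show j ≠ i + 1 by omega, show j ≠ i by omega, show j ≠ i - 1 by omega,
        show i + 1 ≠ j by omega, show i ≠ j by omega, show j + 1 ≠ i by omega]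
    · simp [← h, show i + 1 ≠ i - 1 by omega]
    · rcases lt_trichotomy (j + 1) i with h | h | h
      · simp [show j ≠ i + 1 by omega, show j ≠ i by omega, show j ≠ i - 1 by omega,
          show i + 1 ≠ j by omega, show i ≠ j by omega, show j + 1 ≠ i by omega]
      · simp [← h, show j + 1 + 1 ≠ j by omega, show j ≠ j + 1 + 1 by omega]
      · obtain rfl : i = j := by omega
        rcases i with _ | i <;> simp
  simp only [h, Finset.sum_add_distrib]
  rw [sum_ite_val_eq _ _ fun _ => upperEntry k i, sum_ite_val_eq _ _ fun _ => D,
    sum_ite_val_eq _ _ fun _ => if 0 < i then lowerEntry (m + 2) c i else 0, if_pos hi,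
    if_pos (show i - 1 < m + 2 by omega), hD]
  ring

section DistanceRegular

variable {V : Type*} [Fintype V] {G : SimpleGraph V} {k m : ℕ} {c : ℝ}

theorem isDistanceRegular_of_hasDistanceQuotient (hconn : G.Connected) {t : ℕ}
    {Q : Matrix (Fin t) (Fin t) ℝ} (h : HasDistanceQuotient G Q) : IsDistanceRegular G := by
  refine ⟨hconn, fun i j => ?_⟩
  by_cases hij : i < t ∧ j < t
  · by_cases hex : ∃ x y, G.dist x y = i
    · obtain ⟨x₀, y₀, h₀⟩ := hex
      refine ⟨neighborsAtDist G x₀ y₀ j, fun x y hxy => ?_⟩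
      have h1 := (h x₀).2.2 ⟨i, hij.1⟩ ⟨j, hij.2⟩ y₀ h₀
      have h2 := (h x).2.2 ⟨i, hij.1⟩ ⟨j, hij.2⟩ y hxy
      exact_mod_cast h2.trans h1.symm
    · exact ⟨0, fun x y hxy => (hex ⟨x, y, hxy⟩).elim⟩
  · refine ⟨0, fun x y hxy => ?_⟩
    have hi := (h x).1 y
    have hj : t ≤ j := by omega
    rw [neighborsAtDist, Set.ncard_eq_zero]
    refine Set.eq_empty_of_forall_notMem fun z hz => ?_
    have := (h x).1 z
    have := hz.2
    omega

theorem hasIntersectionArray_of_hasDistanceQuotient (hconn : G.Connected)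
    (h : HasDistanceQuotient G (T k (m + 2) c)) :
    HasIntersectionArray G (m + 1) (upperEntry k) (lowerEntry (m + 2) c) := by
  have := hconn.nonempty
  refine ⟨isDistanceRegular_of_hasDistanceQuotient hconn h, ?_, fun x y hxy => ?_,
    fun x y hxy => ?_⟩
  · obtain ⟨u, v, huv⟩ := G.exists_dist_eq_diam
    have h1 := (h u).1 v
    obtain ⟨y, hy⟩ := (h u).2.1 (Fin.last (m + 1))
    have h2 := SimpleGraph.dist_le_diam (SimpleGraph.connected_iff_ediam_ne_top.1 hconn)
      (u := u) (v := y)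
    rw [Fin.val_last] at hy
    omega
  · have := (h x).2.2 ⟨G.dist x y, by omega⟩ ⟨G.dist x y + 1, by omega⟩ y rfl
    simpa [T] using this
  · have hlt := (h x).1 y
    have := (h x).2.2 ⟨G.dist x y, hlt⟩ ⟨G.dist x y - 1, by omega⟩ y rfl
    rw [this]
    simp [T, show G.dist x y + 1 ≠ G.dist x y - 1 by omega,
      show G.dist x y - 1 + 1 = G.dist x y by omega]

theorem neighborsAtDist_eq_card [DecidableRel G.Adj] (x y : V) (j : ℕ) :
    neighborsAtDist G x y j = (Finset.univ.filter fun z => G.Adj y z ∧ G.dist x z = j).card := by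
  rw [neighborsAtDist, ← Set.ncard_coe_finset]
  simp

/-- Double counting of the edges between two consecutive distance layers. -/
theorem card_mul_neighborsAtDist_succ (x : V) (i : ℕ) {b c : ℝ}
    (hb : ∀ y, G.dist x y = i → (neighborsAtDist G x y (i + 1) : ℝ) = b)
    (hc : ∀ y, G.dist x y = i + 1 → (neighborsAtDist G x y i : ℝ) = c) :
    ((Finset.univ.filter fun y => G.dist x y = i + 1).card : ℝ) * c =
      (Finset.univ.filter fun y => G.dist x y = i).card * b := by
  classical
  have h := Finset.sum_card_bipartiteAbove_eq_sum_card_bipartiteBelow G.Adj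
    (s := Finset.univ.filter fun y => G.dist x y = i)
    (t := Finset.univ.filter fun y => G.dist x y = i + 1)
  have h1 : ∑ y ∈ Finset.univ.filter (fun y => G.dist x y = i), ((Finset.bipartiteAbove G.Adj
      (Finset.univ.filter fun y => G.dist x y = i + 1) y).card : ℝ) =
      ∑ y ∈ Finset.univ.filter (fun y => G.dist x y = i), b := by
    refine Finset.sum_congr rfl fun y hy => ?_
    rw [← hb y (Finset.mem_filter.1 hy).2, neighborsAtDist_eq_card]
    congr 2
    ext z
    simp [Finset.mem_bipartiteAbove, and_comm]
  have h2 : ∑ y ∈ Finset.univ.filter (fun y => G.dist x y = i + 1), ((Finset.bipartiteBelow G.Adj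
      (Finset.univ.filter fun y => G.dist x y = i) y).card : ℝ) =
      ∑ y ∈ Finset.univ.filter (fun y => G.dist x y = i + 1), c := by
    refine Finset.sum_congr rfl fun y hy => ?_
    rw [← hc y (Finset.mem_filter.1 hy).2, neighborsAtDist_eq_card]
    congr 2
    ext z
    simp [Finset.mem_bipartiteBelow, and_comm, G.adj_comm]
  rw [Finset.sum_const, nsmul_eq_mul] at h1 h2
  rw [← h1, ← h2]
  exact_mod_cast h.symm

/-- The layers have the sizes of those of the tree, except that the last one is divided by `c`. No
eigenvalue is involved. -/
theorem card_eq_M_of_hasIntersectionArray (hc : 0 < c)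
    (h : HasIntersectionArray G (m + 1) (upperEntry k) (lowerEntry (m + 2) c)) :
    (Fintype.card V : ℝ) = M k (m + 2) c := by
  obtain ⟨⟨hconn, -⟩, hdiam, hb, hl⟩ := h
  obtain ⟨x⟩ := hconn.nonempty
  have hdist (y : V) : G.dist x y < m + 2 := by
    have := hconn.nonempty
    have := SimpleGraph.dist_le_diam (SimpleGraph.connected_iff_ediam_ne_top.1 hconn)
      (u := x) (v := y)
    omega
  set n : ℕ → ℝ := fun i => ((Finset.univ.filter fun y => G.dist x y = i).card : ℝ) with hn
  have hstep (i : ℕ) (hi : i ≤ m) :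
      n (i + 1) * lowerEntry (m + 2) c (i + 1) = n i * upperEntry k i := by
    refine card_mul_neighborsAtDist_succ x i (fun y hy => ?_) fun y hy => ?_
    · have := hb x y (by omega)
      rwa [hy] at this
    · have := hl x y (by omega)
      rwa [hy] at this
  have hupper (i : ℕ) : treeLayer k i * upperEntry k i = treeLayer k (i + 1) := by
    cases i <;> simp [treeLayer, upperEntry, pow_succ, mul_assoc]
  have hlayer (i : ℕ) (hi : i ≤ m) : n i = treeLayer k i := by
    induction i with
    | zero =>
      have : (Finset.univ.filter fun y => G.dist x y = 0) = {x} := by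
        ext y
        simp [hconn.dist_eq_zero_iff, eq_comm]
      simp [hn, this, treeLayer]
    | succ i ih =>
      have := hstep i (by omega)
      rwa [ih (by omega), hupper, lowerEntry, if_neg (by omega), mul_one] at this
  have hlast : n (m + 1) * c = treeLayer k (m + 1) := by
    have := hstep m le_rfl
    rwa [hlayer m le_rfl, hupper, lowerEntry, if_pos rfl] at this
  have hcard : (Fintype.card V : ℝ) = ∑ i ∈ Finset.range (m + 2), n i := by
    rw [← Finset.card_univ, Finset.card_eq_sum_card_fiberwise (f := fun y => G.dist x y)
      (t := Finset.range (m + 2)) fun y _ => by simpa using hdist y]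
    push_cast
    rfl
  refine mul_left_cancel₀ hc.ne' ?_
  rw [mul_M k m hc, hcard, Finset.sum_range_succ, mul_add, ← hlast, mul_comm c (n (m + 1)),
    Finset.sum_congr rfl fun i hi => hlayer i (Nat.lt_succ_iff.1 (Finset.mem_range.1 hi))]

variable [DecidableEq V] [DecidableRel G.Adj]

/-- If the comparison with the all-one matrix is sharp, then the non-backtracking matrices are
multiples of the distance matrices. -/
theorem nbMatrix_eq_of_nbSum_eq (hc : 0 < c) (hG : G.IsRegularOfDegree k) (hconn : G.Connected)
    (hsum : ∀ a b, nbSum G m c a b = c) (a b : V) :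
    G.dist a b < m + 2 ∧ ∀ i < m + 2,
      nbMatrix G i a b = if G.dist a b = i then lowerEntry (m + 2) c i else 0 := by
  have hz (i : ℕ) (hi : i < G.dist a b) : nbMatrix G i a b = 0 :=
    (nbMatrix_apply_eq_zero_of_lt_dist hG hconn i).1 a b hi
  have hp (i : ℕ) (hi : i = G.dist a b) : 0 < nbMatrix G i a b :=
    (nbMatrix_apply_eq_zero_of_lt_dist hG hconn i).2 a b hi
  have hs := hsum a b
  rw [nbSum_apply] at hs
  rcases le_or_gt (G.dist a b) m with hd | hd
  · have h1 := one_le_nbMatrix (hp _ rfl).ne'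
    have hmem : G.dist a b ∈ Finset.range (m + 1) := Finset.mem_range.2 (by omega)
    rw [← Finset.add_sum_erase _ _ hmem] at hs
    have hrest : 0 ≤ ∑ i ∈ (Finset.range (m + 1)).erase (G.dist a b), nbMatrix G i a b :=
      Finset.sum_nonneg fun i _ => nbMatrix_nonneg i a b
    have hlast := nbMatrix_nonneg (G := G) (m + 1) a b
    -- The count at index `dist a b` is a positive integer and the total is at most `1`, so it
    -- equals `1` and every other count is zero.
    have h2 : nbMatrix G (G.dist a b) a b +
        ∑ i ∈ (Finset.range (m + 1)).erase (G.dist a b), nbMatrix G i a b ≤ 1 :=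
      le_of_mul_le_mul_left (by linarith) hc
    have h3 : ∑ i ∈ (Finset.range (m + 1)).erase (G.dist a b), nbMatrix G i a b = 0 := by linarith
    have h4 : nbMatrix G (G.dist a b) a b = 1 := by linarith
    have h5 : nbMatrix G (m + 1) a b = 0 := by
      rw [h3, h4] at hs
      linarith
    rw [Finset.sum_eq_zero_iff_of_nonneg fun i _ => nbMatrix_nonneg i a b] at h3
    refine ⟨by omega, fun i hi => ?_⟩
    split_ifs with h
    · rw [← h, h4, lowerEntry, if_neg (by omega)]
    · rcases Nat.lt_succ_iff_lt_or_eq.1 hi with hi | rfl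
      · exact h3 i (Finset.mem_erase.2 ⟨fun e => h e.symm, Finset.mem_range.2 hi⟩)
      · exact h5
  · rw [Finset.sum_eq_zero fun i hi => hz i (by have := Finset.mem_range.1 hi; omega), mul_zero,
      zero_add] at hs
    have hd2 : G.dist a b = m + 1 := by
      by_contra hne
      rw [hz (m + 1) (by omega)] at hs
      exact hc.ne hs
    refine ⟨by omega, fun i hi => ?_⟩
    split_ifs with h
    · obtain rfl : i = m + 1 := by omega
      rw [hs, lowerEntry, if_pos rfl]
    · exact hz i (by omega)

theorem neighborsAtDist_eq_adjMatrix_mul (hc : 0 < c) (hG : G.IsRegularOfDegree k)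
    (hconn : G.Connected) (hsum : ∀ a b, nbSum G m c a b = c) (x y : V) {j : ℕ} (hj : j ≤ m) :
    (neighborsAtDist G x y j : ℝ) = (G.adjMatrix ℝ * nbMatrix G j) y x := by
  rw [SimpleGraph.adjMatrix_mul_apply, neighborsAtDist_eq_card]
  have h (z : V) : nbMatrix G j z x = if G.dist x z = j then 1 else 0 := by
    rw [(nbMatrix_eq_of_nbSum_eq hc hG hconn hsum z x).2 j (by omega), lowerEntry,
      if_neg (show j + 1 ≠ m + 2 by omega), G.dist_comm]
  simp only [h, Finset.sum_boole]
  congr 2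
  ext z
  simp

theorem hasDistanceQuotient_of_nbSum_eq (hk : 2 ≤ k) (hc : 0 < c) (hG : G.IsRegularOfDegree k)
    (hconn : G.Connected) (hsum : ∀ a b, nbSum G m c a b = c) :
    HasDistanceQuotient G (T k (m + 2) c) := by
  have hnb := nbMatrix_eq_of_nbSum_eq hc hG hconn hsum
  intro x
  have hdist (y : V) : G.dist x y < m + 2 := (hnb x y).1
  refine ⟨hdist, fun i => ?_, ?_⟩
  · by_contra! hne
    -- An empty cell would make row `x` of `nbMatrix G i` zero, but its sum is the size of a tree
    -- layer.
    have h1 := congrFun (nbMatrix_mulVec_one hG i) x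
    have h2 : (nbMatrix G i).mulVec 1 x = 0 := by
      simp only [Matrix.mulVec, dotProduct, Pi.one_apply, mul_one]
      refine Finset.sum_eq_zero fun y _ => ?_
      rw [(hnb x y).2 i i.2, if_neg (hne y)]
    rw [h2] at h1
    have h3 := treeLayer_pos (k := k) (by exact_mod_cast hk) i
    simp only [Pi.smul_apply, Pi.one_apply, smul_eq_mul, mul_one] at h1
    exact h3.ne h1
  -- For `j ≤ m` the matrix `nbMatrix G j` is exactly the distance-`j` matrix, so the recurrence
  -- expresses neighbour counts by entries already known.
  have hmain (i : Fin (m + 2)) (y : V) (hy : G.dist x y = i) (j : Fin (m + 1)) :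
      (neighborsAtDist G x y j : ℝ) = T k (m + 2) c i j.castSucc := by
    obtain ⟨i, hi⟩ := i
    obtain ⟨j, hj⟩ := j
    have hyx : G.dist y x = i := G.dist_comm.trans hy
    have hval := (hnb y x).2
    rw [hyx] at hval
    rw [neighborsAtDist_eq_adjMatrix_mul hc hG hconn hsum x y (Nat.lt_succ_iff.1 hj)]
    rcases j with _ | _ | j
    · rw [nbMatrix_zero, mul_one, ← nbMatrix_one, hval 1 (by omega)]
      simp only [T, upperEntry, lowerEntry, Matrix.of_apply, Fin.ext_iff, Fin.val_castSucc]
      grind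
    · rw [show nbMatrix G (0 + 1) = nbMatrix G 1 from rfl, adjMatrix_mul_nbMatrix_one hG, Matrix.add_apply, Matrix.smul_apply,
        hval 2 (by omega), hval 0 (by omega)]
      simp only [T, upperEntry, lowerEntry, Matrix.of_apply, Fin.ext_iff, Fin.val_castSucc,
        smul_eq_mul]
      grind
    · rw [adjMatrix_mul_nbMatrix_add_two hG, Matrix.add_apply, Matrix.smul_apply,
        hval (j + 3) (by omega), hval (j + 1) (by omega)]
      simp only [T, upperEntry, lowerEntry, Matrix.of_apply, Fin.ext_iff, Fin.val_castSucc,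
        smul_eq_mul]
      grind
  intro i j y hy
  induction j using Fin.lastCases with
  | cast j => exact hmain i y hy j
  | last =>
    -- The recurrence for the last column would involve walks of length `m + 2`, which are not
    -- controlled; both row sums being `k` settles it instead.
    have h1 := sum_T_row k m c i
    have h2 : ∑ j : Fin (m + 2), (neighborsAtDist G x y j : ℝ) = k := by
      rw [Fin.sum_univ_eq_sum_range fun j => (neighborsAtDist G x y j : ℝ)]
      have h3 := Finset.card_eq_sum_card_fiberwise (s := G.neighborFinset y)
        (f := fun z => G.dist x z) (t := Finset.range (m + 2)) fun z _ => by simpa using hdist z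
      rw [G.card_neighborFinset_eq_degree, hG.degree_eq] at h3
      rw [h3]
      push_cast
      refine Finset.sum_congr rfl fun j _ => ?_
      rw [neighborsAtDist_eq_card]
      congr 2
      ext z
      simp
    rw [Fin.sum_univ_castSucc] at h1 h2
    have h3 := Finset.sum_congr rfl fun (j : Fin (m + 1)) (_ : j ∈ Finset.univ) => hmain i y hy j
    simp only [Fin.val_castSucc] at h2
    linarith

end DistanceRegular

/-! ### Conclusion for admissible graphs and for `maxOrder`. -/

/-- The bound for admissible graphs and the characterization of equality. -/
theorem IsAdmissible.card_le_M {k m : ℕ} {c : ℝ} (hk : 2 ≤ k) (hc : 0 < c) {V : Type*} [Fintype V]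
    {G : SimpleGraph V}
    (hG : IsAdmissible k (secondLargestEigenvalue (T k (m + 2) c)) G) :
    (Fintype.card V : ℝ) ≤ M k (m + 2) c ∧
      ((Fintype.card V : ℝ) = M k (m + 2) c → HasDistanceQuotient G (T k (m + 2) c)) := by
  classical
  have hk' : (2 : ℝ) ≤ k := by exact_mod_cast hk
  obtain ⟨hconn, hreg, hsec⟩ := hG
  have := hconn.nonempty
  obtain ⟨x, hx, h0⟩ := exists_diffSeq_pos hk' hc m
  have hxk : x < k := by
    refine sub_pos.1 (pos_of_mul_pos_left ?_ (partialComb_treeLayer_pos hk' hx).le)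
    rw [sub_mul_partialComb_treeLayer hc h0]
    exact mul_pos hc (M_pos hk m hc)
  rw [secondLargestEigenvalue_T hk hx h0 hxk] at hsec
  have hreg' : G.IsRegularOfDegree k := by convert hreg
  have hsec' : secondLargestEigenvalue (G.adjMatrix ℝ) ≤ x := by convert hsec
  obtain ⟨h1, h2⟩ := card_le_M_and_nbSum_eq hk hc hx h0 hreg' hsec'
  exact ⟨h1, fun h => hasDistanceQuotient_of_nbSum_eq hk hc hreg' hconn (h2 h)⟩

theorem exists_maxOrder_eq {k : ℕ} {lam B : ℝ} (hB : 0 ≤ B)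
    (h : ∀ (n : ℕ) (G : SimpleGraph (Fin n)), IsAdmissible k lam G → (n : ℝ) ≤ B) :
    ∃ N : ℕ, maxOrder k lam = N ∧ (N : ℝ) ≤ B := by
  have hle : maxOrder k lam ≤ (⌊B⌋₊ : ℕ∞) := by
    refine sSup_le ?_
    rintro _ ⟨n, rfl, G, hG⟩
    exact_mod_cast Nat.le_floor (h n G hG)
  lift maxOrder k lam to ℕ using ne_top_of_le_ne_top (ENat.natCast_ne_top _) hle with N
  exact ⟨N, rfl, (Nat.cast_le.2 (by exact_mod_cast hle)).trans (Nat.floor_le hB)⟩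

end SpectralOrder

theorem mainTheorem1 (k t : ℕ) (c : ℝ) (hk : 2 ≤ k) (ht : 2 ≤ t) (hc : 0 < c) (lam : ℝ)
    (hlam : lam = SpectralOrder.secondLargestEigenvalue (SpectralOrder.T k t c)) :
    ∃ N : ℕ, SpectralOrder.maxOrder k lam = (N : ℕ∞) ∧
      (N : ℝ) ≤ SpectralOrder.M k t c ∧
      ∀ (V : Type*) [Fintype V] (G : SimpleGraph V),
        SpectralOrder.IsAdmissible k lam G → Fintype.card V = N →
        ((N : ℝ) = SpectralOrder.M k t c ↔
          SpectralOrder.IsDistanceRegular G ∧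
            SpectralOrder.HasDistanceQuotient G (SpectralOrder.T k t c)) ∧
        ((N : ℝ) = SpectralOrder.M k t c ↔
          SpectralOrder.HasIntersectionArray G (t - 1) (SpectralOrder.upperEntry k)
            (SpectralOrder.lowerEntry t c)) := by
  obtain ⟨m, rfl⟩ : ∃ m, t = m + 2 := ⟨t - 2, by omega⟩
  subst hlam
  obtain ⟨N, hN, hNM⟩ := SpectralOrder.exists_maxOrder_eq (SpectralOrder.M_pos hk m hc).le
    fun n G hG => by simpa using (hG.card_le_M hk hc).1
  refine ⟨N, hN, hNM, fun V _ G hG hcard => ?_⟩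
  have hquot := (hG.card_le_M hk hc).2
  rw [hcard] at hquot
  have hM (h : SpectralOrder.HasIntersectionArray G (m + 1) (SpectralOrder.upperEntry k)
      (SpectralOrder.lowerEntry (m + 2) c)) : (N : ℝ) = SpectralOrder.M k (m + 2) c := by
    rw [← hcard]
    exact SpectralOrder.card_eq_M_of_hasIntersectionArray hc h
  exact ⟨⟨fun h => ⟨SpectralOrder.isDistanceRegular_of_hasDistanceQuotient hG.1 (hquot h), hquot h⟩,
    fun h => hM (SpectralOrder.hasIntersectionArray_of_hasDistanceQuotient hG.1 h.2)⟩,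
    ⟨fun h => SpectralOrder.hasIntersectionArray_of_hasDistanceQuotient hG.1 (hquot h), hM⟩⟩
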